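/- Let $\mathbb{T}\subseteq\mathbb{R}$ be a time scale (a nonempty closed set) with forward jump operator $\sigma(t)=\inf\{s\in\mathbb{T}: s>t\}$ (and $\sigma(\max\mathbb{T})=\max\mathbb{T}$ if the maximum exists), backward jump operator $\rho(t)=\sup\{s\in\mathbb{T}: s<t\}$ (and $\rho(\min\mathbb{T})=\min\mathbb{T}$ if the minimum exists), and graininess $\mu(t)=\sigma(t)-t$. The delta derivative of $f:\mathbb{T}\to\mathbb{C}$ is $f^\Delta(t)=\lim_{s\to t,\ s\in\mathbb{T},\ s\neq\sigma(t)}\frac{f(\sigma(t))-f(s)}{\sigma(t)-s}$ (no condition being imposed at a maximum of $\mathbb{T}$ that is isolated in $\mathbb{T}$), and $\int_a^b f(s)\,\Delta s=F(b)-F(a)$ for $a,b\in\mathbb{T}$, where $F^\Delta=f$ on $\mathbb{T}$. Let $t_0\in\mathbb{T}$ and let $\alpha:\mathbb{T}\to\mathbb{C}$ be regressive, i.e. $\mu(t)\alpha(t)\neq\pm2$ for all $t\in\mathbb{T}$, and rd-continuous, i.e. continuous at every $t\in\mathbb{T}$ with $\sigma(t)=t$ and possessing a finite left-sided limit at every $t\in\mathbb{T}$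 with $\rho(t)=t$ (a void condition at $\min\mathbb{T}$). For $m\in\mathbb{R}$ and $z\in\mathbb{C}$ with $mz\neq\pm2$ put $$\zeta_m(z)=\frac1m\log\frac{1+\frac12 zm}{1-\frac12 zm}\quad(m\neq0),\qquad \zeta_0(z)=z,$$ where $\log$ is the principal branch; thus $z=\frac2m\tanh\frac{m\,\zeta_m(z)}2$ for $m\neq0$. Then $s\mapsto\zeta_{\mu(s)}(\alpha(s))$ has a delta antiderivative on $\mathbb{T}$, and the Cayley-exponential function $E_\alpha(\cdot,t_0)$, i.e. the solution $x:\mathbb{T}\to\mathbb{C}$ of the initial value problem $$x^\Delta(t)=\alpha(t)\,\frac{x(t)+x(\sigma(t))}2\quad(t\in\mathbb{T}),\qquad x(t_0)=1,$$ exists, is unique, and is given by $$E_\alpha(t,t_0)=\exp\left(\int_{t_0}^t\zeta_{\mu(s)}(\alpha(s))\,\Delta s\right)\qquad(t\in\mathbb{T}).$$ -/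

import Mathlib

open Filter Topology Set

/-! Calculus on a time scale, i.e. a nonempty closed set `T` of real numbers.
Functions on `T` are represented by functions `ℝ → ℂ`; every notion below uses only their values
at points of `T`. -/

namespace TimeScale

open Classical in
/-- The forward jump operator `σ(t) = inf {s ∈ T : s > t}`, with the usual convention
`σ(max T) = max T`. -/
noncomputable def sigma (T : Set ℝ) (t : ℝ) : ℝ :=
  if (T ∩ Ioi t).Nonempty then sInf (T ∩ Ioi t) else t

open Classical in
/-- The backward jump operator `ρ(t) = sup {s ∈ T : s < t}`, with the usual convention
`ρ(min T) = min T`. -/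
noncomputable def rho (T : Set ℝ) (t : ℝ) : ℝ :=
  if (T ∩ Iio t).Nonempty then sSup (T ∩ Iio t) else t

/-- The graininess `μ(t) = σ(t) - t`. -/
noncomputable def graininess (T : Set ℝ) (t : ℝ) : ℝ := sigma T t - t

/-- `f` is rd-continuous on `T`: it is continuous at right-dense points and has a finite
(left-sided) limit at left-dense points. -/
def RdContinuous (T : Set ℝ) (f : ℝ → ℂ) : Prop :=
  (∀ t ∈ T, sigma T t = t → ContinuousWithinAt f T t) ∧
  (∀ t ∈ T, rho T t = t → ∃ l : ℂ, Tendsto f (𝓝[T ∩ Iio t] t) (𝓝 l))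

/-- `f` is regressive: `μ f ≠ ± 2` on `T`. -/
def Regressive (T : Set ℝ) (f : ℝ → ℂ) : Prop :=
  ∀ t ∈ T, (graininess T t : ℂ) * f t ≠ 2 ∧ (graininess T t : ℂ) * f t ≠ -2

/-- `f` has delta derivative `d` at `t`: the quotient `(f(σ(t)) - f(s)) / (σ(t) - s)` tends to `d`
as `s → t` in `T`, `s ≠ σ(t)`. (The point `s = t` is allowed when `t` is right-scattered. At a
left-scattered maximum of `T` there are no admissible `s` near `t`, and the condition is void,
as it should be: delta derivatives are not considered at such a point.) -/
def HasDeltaDerivAt (T : Set ℝ) (f : ℝ → ℂ) (d : ℂ) (t : ℝ) : Prop :=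
  Tendsto (fun s : ℝ => (f (sigma T t) - f s) / ((sigma T t : ℂ) - (s : ℂ)))
    (𝓝[T \ {sigma T t}] t) (𝓝 d)

/-- `F` is a delta antiderivative of `f` on `T`. -/
def IsDeltaAntideriv (T : Set ℝ) (F f : ℝ → ℂ) : Prop :=
  ∀ t ∈ T, HasDeltaDerivAt T F (f t) t

/-- `f` has a delta antiderivative on `T`, so that its (Cauchy) delta integrals exist. -/
def DeltaIntegrable (T : Set ℝ) (f : ℝ → ℂ) : Prop :=
  ∃ F : ℝ → ℂ, IsDeltaAntideriv T F f

open Classical in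
/-- The (Cauchy) delta integral `∫_a^b f(s) Δs = F(b) - F(a)`, for `a, b ∈ T`, where `F` is a delta
antiderivative of `f`; two antiderivatives differ on `T` by a constant. The value is `0` by
convention if `f` has no antiderivative. -/
noncomputable def deltaIntegral (T : Set ℝ) (f : ℝ → ℂ) (a b : ℝ) : ℂ :=
  if h : DeltaIntegrable T f then h.choose b - h.choose a else 0

/-- The average `⟨x⟩ = (x + x^σ) / 2`. -/
noncomputable def average (T : Set ℝ) (x : ℝ → ℂ) (t : ℝ) : ℂ := (x t + x (sigma T t)) / 2

/-- `x = E_α(·, t₀)`: `x` solves `x^Δ = α ⟨x⟩` on `T`, `x(t₀) = 1`. -/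
def IsCayleyExp (T : Set ℝ) (α : ℝ → ℂ) (t₀ : ℝ) (x : ℝ → ℂ) : Prop :=
  (∀ t ∈ T, HasDeltaDerivAt T x (α t * average T x t) t) ∧ x t₀ = 1

/-- The function `ζ_m(z) = (1/m) log ((1 + z m / 2) / (1 - z m / 2))`, `m ≠ 0`, with the principal
logarithm, and `ζ_0(z) = z`. -/
noncomputable def zeta (m : ℝ) (z : ℂ) : ℂ :=
  if m = 0 then z
  else (1 / (m : ℂ)) * Complex.log ((1 + z * (m : ℂ) / 2) / (1 - z * (m : ℂ) / 2))

end TimeScale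

namespace TimeScale

/-! Let `F` be a delta antiderivative of the exponent. At a right-scattered point the dynamic
equation is one linear relation between `x t` and `x (sigma T t)`; regressivity makes it equivalent
to multiplication by `exp (μ ζ)` (`cayley_step_iff`), and `μ ζ` is exactly the increment of `F`. At
a right-dense point `μ = 0`, `ζ = α`, and the equation is the ordinary `x' = α x`. So `exp (F t - F
t₀)` is a solution. Conversely, for any solution `x`, the product `x * exp (-(F - F t₀))` has zero
delta derivative, hence is constant.

Both analytic inputs come from extending functions on `T` to step-like functions on the line through
`floor T`: functions with zero delta derivative are constant, and rd-continuous functions have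
antiderivatives. The latter applies because `ζ` inherits rd-continuity from `α`: graininess tends to
`0` wherever a limit is required. -/

/-! ### The last point of a time scale before a given real number -/

/-- The largest point of `T` not exceeding `s`. -/
noncomputable def floor (T : Set ℝ) (s : ℝ) : ℝ := sSup (T ∩ Iic s)

variable {T : Set ℝ}

lemma bddAbove_inter_Iic (s : ℝ) : BddAbove (T ∩ Iic s) := ⟨s, fun _ hu => hu.2⟩

lemma floor_mem (hT : IsClosed T) {a s : ℝ} (ha : a ∈ T) (has : a ≤ s) : floor T s ∈ T :=
  ((hT.inter isClosed_Iic).csSup_mem ⟨a, ha, has⟩ (bddAbove_inter_Iic s)).1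

lemma floor_le (hT : IsClosed T) {a s : ℝ} (ha : a ∈ T) (has : a ≤ s) : floor T s ≤ s :=
  ((hT.inter isClosed_Iic).csSup_mem ⟨a, ha, has⟩ (bddAbove_inter_Iic s)).2

lemma le_floor {a s : ℝ} (ha : a ∈ T) (has : a ≤ s) : a ≤ floor T s :=
  le_csSup (bddAbove_inter_Iic s) ⟨ha, has⟩

lemma floor_eq_self (hT : IsClosed T) {t : ℝ} (ht : t ∈ T) : floor T t = t :=
  le_antisymm (floor_le hT ht le_rfl) (le_floor ht le_rfl)

lemma floor_eq_of_gap {s u : ℝ} (h : s ≤ u) (hgap : ∀ v ∈ T, s < v → u < v) :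
    floor T u = floor T s := by
  unfold floor
  congr 1
  ext v
  constructor
  · rintro ⟨hv, hvu⟩
    exact ⟨hv, not_lt.1 fun hsv => absurd (hgap v hv hsv) (not_lt.2 hvu)⟩
  · rintro ⟨hv, hvs⟩
    exact ⟨hv, le_trans hvs h⟩

/-! ### Jump operators -/

lemma sigma_mem (hT : IsClosed T) {t : ℝ} (ht : t ∈ T) : sigma T t ∈ T := by
  unfold sigma
  split_ifs with h
  · exact closure_minimal inter_subset_left hT
      (csInf_mem_closure h ⟨t, fun _ hu => hu.2.le⟩)
  · exact ht

lemma le_sigma (T : Set ℝ) (t : ℝ) : t ≤ sigma T t := by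
  unfold sigma
  split_ifs with h
  · exact le_csInf h fun _ hu => hu.2.le
  · exact le_rfl

lemma sigma_le {t u : ℝ} (hu : u ∈ T) (htu : t < u) : sigma T t ≤ u := by
  unfold sigma
  rw [if_pos ⟨u, hu, htu⟩]
  exact csInf_le ⟨t, fun _ hv => hv.2.le⟩ ⟨hu, htu⟩

lemma exists_mem_Ioo_of_sigma_eq {t u b : ℝ} (h : sigma T t = t) (hu : u ∈ T) (htu : t < u)
    (hb : t < b) : ∃ v ∈ T, t < v ∧ v < b := by
  have hne : (T ∩ Ioi t).Nonempty := ⟨u, hu, htu⟩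
  unfold sigma at h
  rw [if_pos hne] at h
  obtain ⟨v, hv, hvb⟩ := exists_lt_of_csInf_lt hne (h.trans_lt hb)
  exact ⟨v, hv.1, hv.2, hvb⟩

lemma le_rho {t u : ℝ} (hu : u ∈ T) (hut : u < t) : u ≤ rho T t := by
  unfold rho
  rw [if_pos ⟨u, hu, hut⟩]
  exact le_csSup ⟨t, fun _ hv => hv.2.le⟩ ⟨hu, hut⟩

lemma rho_le (T : Set ℝ) (t : ℝ) : rho T t ≤ t := by
  unfold rho
  split_ifs with h
  · exact csSup_le h fun _ hu => hu.2.le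
  · exact le_rfl

lemma rho_mem (hT : IsClosed T) {t : ℝ} (ht : t ∈ T) : rho T t ∈ T := by
  unfold rho
  split_ifs with h
  · exact closure_minimal inter_subset_left hT
      (csSup_mem_closure h ⟨t, fun _ hu => hu.2.le⟩)
  · exact ht

lemma exists_mem_Ioo_of_rho_eq {t u b : ℝ} (h : rho T t = t) (hu : u ∈ T) (hut : u < t)
    (hb : b < t) : ∃ v ∈ T, b < v ∧ v < t := by
  have hne : (T ∩ Iio t).Nonempty := ⟨u, hu, hut⟩
  unfold rho at h
  rw [if_pos hne] at h
  obtain ⟨v, hv, hbv⟩ := exists_lt_of_lt_csSup hne (hb.trans_eq h.symm)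
  exact ⟨v, hv.1, hbv, hv.2⟩

lemma sigma_rho {t : ℝ} (ht : t ∈ T) (h : rho T t < t) :
    sigma T (rho T t) = t := by
  refine le_antisymm (sigma_le ht h) ?_
  have hne : (T ∩ Ioi (rho T t)).Nonempty := ⟨t, ht, h⟩
  unfold sigma
  rw [if_pos hne]
  refine le_csInf hne fun u hu => not_lt.1 fun hut => ?_
  exact absurd (le_rho hu.1 hut) (not_le.2 hu.2)

lemma graininess_nonneg (T : Set ℝ) (t : ℝ) : 0 ≤ graininess T t := sub_nonneg.2 (le_sigma T t)

/-! ### Local behaviour of `floor` -/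

lemma floor_eventuallyEq_of_notMem (hT : IsClosed T) {s : ℝ} (hs : s ∉ T) :
    ∀ᶠ u in 𝓝 s, floor T u = floor T s := by
  obtain ⟨ε, hε, hball⟩ := Metric.isOpen_iff.1 hT.isOpen_compl s hs
  have hgap : ∀ v ∈ T, ¬ (s - ε < v ∧ v < s + ε) := fun v hv h =>
    hball (by rw [Metric.mem_ball, Real.dist_eq, abs_lt]; constructor <;> linarith [h.1, h.2]) hv
  filter_upwards [Ioo_mem_nhds (sub_lt_self s hε) (lt_add_of_pos_right s hε)] with u hu
  rcases le_total s u with h | h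
  · exact floor_eq_of_gap h fun v hv hsv => not_le.1 fun hvu =>
      hgap v hv ⟨by linarith [hu.1], by linarith [hu.2]⟩
  · exact (floor_eq_of_gap h fun v hv hsv => not_le.1 fun hvu =>
      hgap v hv ⟨by linarith [hu.1], by linarith [hu.2]⟩).symm

lemma floor_eq_of_mem_Ico (hT : IsClosed T) {t u : ℝ} (ht : t ∈ T)
    (hu : u ∈ Ico t (sigma T t)) : floor T u = t := by
  rw [floor_eq_of_gap hu.1 fun v hv htv => hu.2.trans_le (sigma_le hv htv), floor_eq_self hT ht]

lemma floor_eventuallyEq_right (hT : IsClosed T) {t : ℝ} (ht : t ∈ T) (h : t < sigma T t) :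
    ∀ᶠ u in 𝓝[≥] t, floor T u = t := by
  filter_upwards [Ico_mem_nhdsGE h] with u hu using floor_eq_of_mem_Ico hT ht hu

lemma tendsto_floor_right (hT : IsClosed T) {t : ℝ} (ht : t ∈ T) :
    Tendsto (floor T) (𝓝[≥] t) (𝓝[T] t) := by
  refine tendsto_nhdsWithin_iff.2 ⟨?_, ?_⟩
  · refine tendsto_of_tendsto_of_tendsto_of_le_of_le' tendsto_const_nhds
      (tendsto_id.mono_left nhdsWithin_le_nhds) ?_ ?_
    · filter_upwards [self_mem_nhdsWithin] with u hu using le_floor ht hu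
    · filter_upwards [self_mem_nhdsWithin] with u hu using floor_le hT ht hu
  · filter_upwards [self_mem_nhdsWithin] with u hu using floor_mem hT ht hu

/-- Below `min T` the value of `floor` is the default `sSup ∅`; only its constancy matters. -/
lemma floor_eventuallyEq_left_of_isMin {t : ℝ} (h : ∀ u ∈ T, t ≤ u) :
    ∀ᶠ u in 𝓝[<] t, floor T u = sSup ∅ := by
  filter_upwards [self_mem_nhdsWithin] with u hu
  unfold floor
  congr 1
  exact eq_empty_of_forall_notMem fun v hv =>
    absurd (h v hv.1) (not_le.2 (lt_of_le_of_lt hv.2 hu))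

lemma floor_eventuallyEq_left (hT : IsClosed T) {t : ℝ} (ht : t ∈ T) (h : rho T t < t) :
    ∀ᶠ u in 𝓝[<] t, floor T u = rho T t := by
  filter_upwards [Ico_mem_nhdsLT h] with u hu
  refine floor_eq_of_mem_Ico hT (rho_mem hT ht) ⟨hu.1, ?_⟩
  rw [sigma_rho ht h]
  exact hu.2

lemma tendsto_floor_left (hT : IsClosed T) {a t : ℝ} (ha : a ∈ T) (hat : a < t)
    (h : rho T t = t) : Tendsto (floor T) (𝓝[<] t) (𝓝[T ∩ Iio t] t) := by
  have hev : ∀ᶠ u in 𝓝[<] t, a ≤ u ∧ u < t := by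
    filter_upwards [Ico_mem_nhdsLT hat] with u hu using hu
  refine tendsto_nhdsWithin_iff.2 ⟨tendsto_order.2 ⟨fun b hb => ?_, fun b hb => ?_⟩, ?_⟩
  · obtain ⟨v, hv, hbv, hvt⟩ := exists_mem_Ioo_of_rho_eq h ha hat hb
    filter_upwards [Ico_mem_nhdsLT hvt] with u hu using hbv.trans_le (le_floor hv hu.1)
  · filter_upwards [hev] with u hu using (floor_le hT ha hu.1).trans_lt (hu.2.trans hb)
  · filter_upwards [hev] with u hu using
      ⟨floor_mem hT ha hu.1, (floor_le hT ha hu.1).trans_lt hu.2⟩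

/-! ### Delta derivatives -/

/-- Here `s = t` is admissible, so the limit must equal the quotient at `t` itself. -/
lemma hasDeltaDerivAt_iff_of_lt {F : ℝ → ℂ} {d : ℂ} {t : ℝ} (ht : t ∈ T) (h : t < sigma T t) :
    HasDeltaDerivAt T F d t ↔
      ContinuousWithinAt F T t ∧ F (sigma T t) - F t = (graininess T t : ℂ) * d := by
  have hfil : 𝓝[T \ {sigma T t}] t = 𝓝[T] t := by
    rw [sdiff_eq]
    exact nhdsWithin_inter_of_mem' (mem_nhdsWithin_of_mem_nhds
      (isOpen_compl_singleton.mem_nhds (by simpa using h.ne)))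
  have hne : ((sigma T t : ℂ) - (t : ℂ)) ≠ 0 := by
    rw [← Complex.ofReal_sub]; exact Complex.ofReal_ne_zero.2 (sub_pos.2 h).ne'
  have hev : ∀ᶠ s : ℝ in 𝓝[T] t, ((sigma T t : ℂ) - (s : ℂ)) ≠ 0 := by
    filter_upwards [mem_nhdsWithin_of_mem_nhds (Iio_mem_nhds h)] with s hs
    rw [← Complex.ofReal_sub]; exact Complex.ofReal_ne_zero.2 (sub_pos.2 hs).ne'
  have hden : Tendsto (fun s : ℝ => (sigma T t : ℂ) - (s : ℂ)) (𝓝[T] t)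
      (𝓝 ((sigma T t : ℂ) - (t : ℂ))) :=
    ((continuous_const.sub Complex.continuous_ofReal).tendsto t).mono_left nhdsWithin_le_nhds
  have hgr : (graininess T t : ℂ) = (sigma T t : ℂ) - (t : ℂ) := by
    simp [graininess]
  unfold HasDeltaDerivAt
  rw [hfil, hgr]
  constructor
  · intro hF
    have hval : (F (sigma T t) - F t) / ((sigma T t : ℂ) - (t : ℂ)) = d :=
      tendsto_nhds_unique (tendsto_pure_nhds _ t)
        (hF.mono_left (pure_le_nhdsWithin ht))
    have hval' : F (sigma T t) - F t = ((sigma T t : ℂ) - (t : ℂ)) * d := by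
      rw [← hval]; field_simp
    refine ⟨?_, hval'⟩
    have hlim := (tendsto_const_nhds (x := F (sigma T t))).sub (hF.mul hden)
    have : F (sigma T t) - d * ((sigma T t : ℂ) - (t : ℂ)) = F t := by
      linear_combination hval'
    rw [this] at hlim
    refine hlim.congr' ?_
    filter_upwards [hev] with s hs
    rw [div_mul_cancel₀ _ hs]; ring
  · rintro ⟨hc, hval⟩
    have := (hc.tendsto.const_sub (F (sigma T t))).div hden hne
    rwa [hval, mul_div_cancel_left₀ _ hne] at this

lemma hasDeltaDerivAt_iff_of_eq {F : ℝ → ℂ} {d : ℂ} {t : ℝ} (h : sigma T t = t) :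
    HasDeltaDerivAt T F d t ↔ HasDerivWithinAt F d T t := by
  unfold HasDeltaDerivAt
  rw [hasDerivWithinAt_iff_tendsto_slope, h]
  refine tendsto_congr fun s => ?_
  rw [slope_def_module, Complex.real_smul, ← neg_sub (F s), ← neg_sub (s : ℂ), neg_div_neg_eq,
    div_eq_inv_mul]
  push_cast
  ring

lemma HasDeltaDerivAt.continuousWithinAt {F : ℝ → ℂ} {d : ℂ} {t : ℝ} (ht : t ∈ T)
    (h : HasDeltaDerivAt T F d t) : ContinuousWithinAt F T t := by
  rcases (le_sigma T t).lt_or_eq with hs | hs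
  · exact ((hasDeltaDerivAt_iff_of_lt ht hs).1 h).1
  · exact ((hasDeltaDerivAt_iff_of_eq hs.symm).1 h).continuousWithinAt

/-- The extension `q ∘ floor T` is continuous with zero right derivative on `[a, b]`, so the
classical constancy theorem applies. -/
lemma eq_of_hasDeltaDerivAt_zero_of_le (hT : IsClosed T) {q : ℝ → ℂ}
    (hq : ∀ t ∈ T, HasDeltaDerivAt T q 0 t) {a b : ℝ} (ha : a ∈ T) (hb : b ∈ T) (hab : a ≤ b) :
    q b = q a := by
  have hright : ∀ s, a ≤ s → HasDerivWithinAt (q ∘ floor T) 0 (Ici s) s := by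
    intro s has
    have hconst : (∀ᶠ u in 𝓝[≥] s, floor T u = floor T s) →
        HasDerivWithinAt (q ∘ floor T) 0 (Ici s) s := fun h =>
      (hasDerivWithinAt_const s (Ici s) (q (floor T s))).congr_of_eventuallyEq
        (h.mono fun u hu => by simp [hu]) rfl
    by_cases hs : s ∈ T
    · rcases (le_sigma T s).lt_or_eq with h | h
      · refine hconst ?_
        rw [floor_eq_self hT hs]
        exact floor_eventuallyEq_right hT hs h
      · have hd := (hasDeltaDerivAt_iff_of_eq h.symm).1 (hq s hs)
        rw [hasDerivWithinAt_iff_isLittleO] at hd ⊢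
        have hd' := hd.comp_tendsto (tendsto_floor_right hT hs)
        simp only [smul_zero, sub_zero, Function.comp_def, floor_eq_self hT hs] at hd' ⊢
        -- For `u ≥ s` the floor lies in `[s, u]`, so an error `o(floor u - s)` is also `o(u - s)`.
        refine hd'.trans_isBigO (Asymptotics.IsBigO.of_bound 1 ?_)
        filter_upwards [self_mem_nhdsWithin] with u hu
        have h1 := le_floor hs hu
        have h2 := floor_le hT hs hu
        rw [one_mul, Real.norm_of_nonneg (by linarith), Real.norm_of_nonneg (by linarith)]
        linarith
    · exact hconst ((floor_eventuallyEq_of_notMem hT hs).filter_mono nhdsWithin_le_nhds)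
  have hcont : ContinuousOn (q ∘ floor T) (Icc a b) := by
    intro s hs
    rcases hs.1.eq_or_lt with rfl | has
    · exact (hright a le_rfl).continuousWithinAt.mono fun u hu => hu.1
    refine ContinuousAt.continuousWithinAt (continuousAt_iff_continuous_left'_right'.2 ⟨?_,
      (hright s hs.1).continuousWithinAt.mono Ioi_subset_Ici_self⟩)
    by_cases hsT : s ∈ T
    · unfold ContinuousWithinAt
      rw [Function.comp_apply, floor_eq_self hT hsT]
      rcases (rho_le T s).lt_or_eq with h | h
      · have hrm := rho_mem hT hsT
        -- The zero derivative at `rho T s` forces equal values across the gap, so the extension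
        -- does not jump at `s`.
        have hval := ((hasDeltaDerivAt_iff_of_lt hrm ((sigma_rho hsT h).symm ▸ h)).1
          (hq _ hrm)).2
        rw [sigma_rho hsT h, mul_zero, sub_eq_zero] at hval
        refine tendsto_const_nhds.congr' ?_
        filter_upwards [floor_eventuallyEq_left hT hsT h] with u hu
        rw [Function.comp_apply, hu, hval]
      · exact ((hq s hsT).continuousWithinAt hsT).tendsto.comp
          ((tendsto_floor_left hT ha has h).mono_right (nhdsWithin_mono _ inter_subset_left))
    · refine tendsto_const_nhds.congr' ?_
      filter_upwards [(floor_eventuallyEq_of_notMem hT hsT).filter_mono nhdsWithin_le_nhds]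
        with u hu
      simp [hu]
  have := constant_of_has_deriv_right_zero hcont (fun s hs => hright s hs.1) b ⟨hab, le_rfl⟩
  simpa [floor_eq_self hT ha, floor_eq_self hT hb] using this

/-- A function with vanishing delta derivative is constant. -/
lemma eq_of_hasDeltaDerivAt_zero (hT : IsClosed T) {q : ℝ → ℂ}
    (hq : ∀ t ∈ T, HasDeltaDerivAt T q 0 t) {a b : ℝ} (ha : a ∈ T) (hb : b ∈ T) : q b = q a := by
  rcases le_total a b with h | h
  · exact eq_of_hasDeltaDerivAt_zero_of_le hT hq ha hb h
  · exact (eq_of_hasDeltaDerivAt_zero_of_le hT hq hb ha h).symm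

/-! ### Antiderivatives of rd-continuous functions -/

/-- A right-continuous function on the line is measurable. -/
lemma measurable_of_continuousWithinAt_Ioi {f : ℝ → ℂ}
    (hf : ∀ s, ContinuousWithinAt f (Ioi s) s) : Measurable f := by
  -- Sample `f` at the first point of the grid of mesh `1/(n+1)` strictly to the right of `s`.
  refine measurable_of_tendsto_metrizable
    (f := fun (n : ℕ) s => f (((⌊(n + 1 : ℝ) * s⌋ : ℝ) + 1) / (n + 1 : ℝ))) (fun n => ?_)
    (tendsto_pi_nhds.2 fun s => ?_)
  · exact (measurable_of_countable fun k : ℤ => f (((k : ℝ) + 1) / (n + 1 : ℝ))).comp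
      (Int.measurable_floor.comp (measurable_const.mul measurable_id))
  · refine (hf s).tendsto.comp (tendsto_nhdsWithin_iff.2 ⟨?_, Eventually.of_forall fun n => ?_⟩)
    · have hlim : Tendsto (fun n : ℕ => s + 1 / ((n : ℝ) + 1)) atTop (𝓝 s) := by
        simpa using (tendsto_const_nhds (x := s)).add
          (tendsto_one_div_add_atTop_nhds_zero_nat (𝕜 := ℝ))
      refine tendsto_of_tendsto_of_tendsto_of_le_of_le tendsto_const_nhds hlim
        (fun n => ?_) (fun n => ?_)
      · have hn : (0 : ℝ) < n + 1 := by positivity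
        rw [le_div_iff₀ hn]
        linarith [Int.lt_floor_add_one ((n + 1 : ℝ) * s)]
      · have hn : (0 : ℝ) < n + 1 := by positivity
        change _ ≤ s + 1 / ((n : ℝ) + 1)
        rw [div_le_iff₀ hn, add_mul s, one_div, inv_mul_cancel₀ hn.ne']
        linarith [Int.floor_le ((n + 1 : ℝ) * s)]
    · have hn : (0 : ℝ) < n + 1 := by positivity
      rw [mem_Ioi, lt_div_iff₀ hn]
      linarith [Int.lt_floor_add_one ((n + 1 : ℝ) * s)]

lemma RdContinuous.continuousWithinAt_comp_floor (hT : IsClosed T) {g : ℝ → ℂ}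
    (hg : RdContinuous T g) (s : ℝ) : ContinuousWithinAt (g ∘ floor T) (Ici s) s := by
  have hconst : (∀ᶠ u in 𝓝[≥] s, floor T u = floor T s) →
      ContinuousWithinAt (g ∘ floor T) (Ici s) s := fun h =>
    tendsto_const_nhds.congr' (h.mono fun u hu => by simp [hu])
  by_cases hs : s ∈ T
  · rcases (le_sigma T s).lt_or_eq with h | h
    · refine hconst ?_
      rw [floor_eq_self hT hs]
      exact floor_eventuallyEq_right hT hs h
    · have := (hg.1 s hs h.symm).tendsto.comp (tendsto_floor_right hT hs)
      unfold ContinuousWithinAt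
      rwa [Function.comp_apply, floor_eq_self hT hs]
  · exact hconst ((floor_eventuallyEq_of_notMem hT hs).filter_mono nhdsWithin_le_nhds)

lemma RdContinuous.exists_tendsto_comp_floor_left (hT : IsClosed T) {g : ℝ → ℂ}
    (hg : RdContinuous T g) (s : ℝ) : ∃ l, Tendsto (g ∘ floor T) (𝓝[<] s) (𝓝 l) := by
  have hconst : ∀ c, (∀ᶠ u in 𝓝[<] s, floor T u = c) →
      ∃ l, Tendsto (g ∘ floor T) (𝓝[<] s) (𝓝 l) := fun c h =>
    ⟨g c, tendsto_const_nhds.congr' (h.mono fun u hu => by simp [hu])⟩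
  by_cases hs : s ∈ T
  · rcases (rho_le T s).lt_or_eq with h | h
    · exact hconst _ (floor_eventuallyEq_left hT hs h)
    · by_cases hmin : ∀ u ∈ T, s ≤ u
      · exact hconst _ (floor_eventuallyEq_left_of_isMin hmin)
      · push Not at hmin
        obtain ⟨a, ha, has⟩ := hmin
        obtain ⟨l, hl⟩ := hg.2 s hs h
        exact ⟨l, hl.comp (tendsto_floor_left hT ha has h)⟩
  · exact hconst _ ((floor_eventuallyEq_of_notMem hT hs).filter_mono nhdsWithin_le_nhds)

-- One-sided limits at every point bound the measurable extension locally.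
open MeasureTheory in
lemma RdContinuous.intervalIntegrable_comp_floor (hT : IsClosed T) {g : ℝ → ℂ}
    (hg : RdContinuous T g) (a b : ℝ) : IntervalIntegrable (g ∘ floor T) volume a b := by
  have hmeas : Measurable (g ∘ floor T) := measurable_of_continuousWithinAt_Ioi fun s =>
    (hg.continuousWithinAt_comp_floor hT s).mono Ioi_subset_Ici_self
  have hloc : LocallyIntegrable (g ∘ floor T) volume := by
    intro s
    have hfin : ∀ A : Set ℝ, volume.FiniteAtFilter (𝓝[A] s) := fun A =>
      (volume.finiteAt_nhds s).filter_mono nhdsWithin_le_nhds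
    have hm : ∀ l : Filter ℝ, StronglyMeasurableAtFilter (g ∘ floor T) l volume := fun l =>
      hmeas.aestronglyMeasurable.stronglyMeasurableAtFilter
    obtain ⟨l, hl⟩ := hg.exists_tendsto_comp_floor_left hT s
    rw [← nhdsLT_sup_nhdsGE]
    exact IntegrableAtFilter.sup_iff.2
      ⟨(hfin _).integrableAtFilter_of_tendsto (hm _) hl,
        (hfin _).integrableAtFilter_of_tendsto (hm _)
          (hg.continuousWithinAt_comp_floor hT s).tendsto⟩
  exact (hloc.integrableOn_isCompact isCompact_uIcc).intervalIntegrable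

lemma floor_mem_uIcc (hT : IsClosed T) {s t u : ℝ} (hs : s ∈ T) (ht : t ∈ T) (hu : u ∈ uIcc t s) :
    floor T u ∈ T ∩ uIcc t s := by
  have hmin : min t s ∈ T := by rcases min_choice t s with h | h <;> rwa [h]
  exact ⟨floor_mem hT hmin hu.1, le_floor hmin hu.1, (floor_le hT hmin hu.1).trans hu.2⟩

/-- An rd-continuous function has a delta antiderivative. -/
lemma RdContinuous.deltaIntegrable (hT : IsClosed T) {g : ℝ → ℂ} (hg : RdContinuous T g) :
    DeltaIntegrable T g := by
  have hint := hg.intervalIntegrable_comp_floor hT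
  -- The base point `0` is arbitrary and need not lie in `T`.
  refine ⟨fun t => ∫ u in (0 : ℝ)..t, (g ∘ floor T) u, fun t ht => ?_⟩
  have hcont : Continuous fun t => ∫ u in (0 : ℝ)..t, (g ∘ floor T) u :=
    intervalIntegral.continuous_primitive hint 0
  rcases (le_sigma T t).lt_or_eq with h | h
  · refine (hasDeltaDerivAt_iff_of_lt ht h).2 ⟨hcont.continuousWithinAt, ?_⟩
    rw [intervalIntegral.integral_interval_sub_left (hint _ _) (hint _ _),
      intervalIntegral.integral_congr_Ioo_of_le h.le (g := fun _ => g t)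
        (fun u hu => by simp [floor_eq_of_mem_Ico hT ht ⟨hu.1.le, hu.2⟩]),
      intervalIntegral.integral_const, Complex.real_smul]
    rfl
  · refine (hasDeltaDerivAt_iff_of_eq h.symm).2 ?_
    rw [hasDerivWithinAt_iff_isLittleO, Asymptotics.isLittleO_iff]
    intro c hc
    obtain ⟨δ, hδ, hball⟩ := Metric.continuousWithinAt_iff.1 (hg.1 t ht h.symm) c hc
    filter_upwards [self_mem_nhdsWithin, mem_nhdsWithin_of_mem_nhds (Metric.ball_mem_nhds t hδ)]
      with s hs hst
    rw [intervalIntegral.integral_interval_sub_left (hint _ _) (hint _ _),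
      ← intervalIntegral.integral_const, ← intervalIntegral.integral_sub (hint _ _) (by simp)]
    -- Floors of points between `t` and `s` stay between them, so continuity of `g` along `T` bounds
    -- the integrand by `c`.
    refine intervalIntegral.norm_integral_le_of_norm_le_const fun u hu => ?_
    obtain ⟨hfT, hf⟩ := floor_mem_uIcc hT hs ht (uIoc_subset_uIcc hu)
    rw [← dist_eq_norm]
    refine (hball hfT (lt_of_le_of_lt ?_ hst)).le
    rw [Real.dist_eq, Real.dist_eq]
    exact abs_sub_left_of_mem_uIcc hf

/-! ### Rd-continuity of the exponent -/

lemma hasDerivAt_log_cayley :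
    HasDerivAt (fun w : ℂ => Complex.log ((1 + w / 2) / (1 - w / 2))) 1 0 := by
  have h1 : HasDerivAt (fun w : ℂ => 1 + w / 2) (1 / 2) 0 :=
    ((hasDerivAt_id (0 : ℂ)).div_const 2).const_add 1
  have h2 : HasDerivAt (fun w : ℂ => 1 - w / 2) (-(1 / 2)) 0 :=
    ((hasDerivAt_id (0 : ℂ)).div_const 2).const_sub 1
  have h := (h1.fun_div h2 (by simp)).clog (by simp)
  convert h using 1
  norm_num

/-- Removing the singularity at `m = 0` puts both cases in one formula, continuous near `m z = 0`.
-/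
lemma zeta_eq_mul_dslope (m : ℝ) (z : ℂ) : zeta m z =
    z * dslope (fun w : ℂ => Complex.log ((1 + w / 2) / (1 - w / 2))) 0 ((m : ℂ) * z) := by
  unfold zeta
  split_ifs with hm
  · rw [hm, Complex.ofReal_zero, zero_mul, dslope_same, hasDerivAt_log_cayley.deriv, mul_one]
  · rcases eq_or_ne z 0 with rfl | hz
    · simp
    have hm' : (m : ℂ) ≠ 0 := Complex.ofReal_ne_zero.2 hm
    rw [dslope_of_ne _ (mul_ne_zero hm' hz), slope_def_field, mul_comm z]
    simp only [zero_div, add_zero, sub_zero, div_one, Complex.log_one]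
    field_simp

lemma tendsto_zeta {l : Filter ℝ} {m : ℝ → ℝ} {f : ℝ → ℂ} {c : ℂ} (hm : Tendsto m l (𝓝 0))
    (hf : Tendsto f l (𝓝 c)) : Tendsto (fun s => zeta (m s) (f s)) l (𝓝 c) := by
  simp only [zeta_eq_mul_dslope]
  have hc := continuousAt_dslope_same.2 hasDerivAt_log_cayley.differentiableAt
  have harg : Tendsto (fun s => (m s : ℂ) * f s) l (𝓝 0) := by
    simpa using ((Complex.continuous_ofReal.tendsto 0).comp hm).mul hf
  have := hf.mul (hc.tendsto.comp harg)
  rwa [dslope_same, hasDerivAt_log_cayley.deriv, mul_one] at this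

lemma tendsto_graininess_left {t : ℝ} (ht : t ∈ T) :
    Tendsto (graininess T) (𝓝[T ∩ Iio t] t) (𝓝 0) := by
  have hlim : Tendsto (fun s => t - s) (𝓝[T ∩ Iio t] t) (𝓝 0) := by
    refine Tendsto.mono_left ?_ nhdsWithin_le_nhds
    simpa using (tendsto_const_nhds (x := t)).sub (tendsto_id (x := 𝓝 t))
  refine tendsto_of_tendsto_of_tendsto_of_le_of_le' tendsto_const_nhds hlim
    (Eventually.of_forall (graininess_nonneg T)) ?_
  filter_upwards [self_mem_nhdsWithin] with s hs
  exact sub_le_sub_right (sigma_le ht hs.2) s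

lemma tendsto_graininess_of_sigma_eq {t : ℝ} (ht : t ∈ T) (h : sigma T t = t) :
    Tendsto (graininess T) (𝓝[T] t) (𝓝 0) := by
  have hsub : T ⊆ (T ∩ Iio t) ∪ (T ∩ Ici t) := fun s hs =>
    (lt_or_ge s t).imp (fun h => ⟨hs, h⟩) (fun h => ⟨hs, h⟩)
  refine Tendsto.mono_left ?_ (nhdsWithin_mono t hsub)
  rw [nhdsWithin_union]
  refine (tendsto_graininess_left ht).sup (tendsto_order.2 ⟨fun b hb =>
    Eventually.of_forall fun s => hb.trans_le (graininess_nonneg T s), fun b hb => ?_⟩)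
  by_cases hmax : ∃ u ∈ T, t < u
  · obtain ⟨u, hu, htu⟩ := hmax
    -- Points of `T` in `[t, v)` cannot jump beyond `v < t + b`.
    obtain ⟨v, hv, htv, hvb⟩ := exists_mem_Ioo_of_sigma_eq h hu htu (lt_add_of_pos_right t hb)
    filter_upwards [self_mem_nhdsWithin, mem_nhdsWithin_of_mem_nhds (Iio_mem_nhds htv)]
      with s hs hsv
    have h1 := sigma_le hv hsv
    have h2 : t ≤ s := hs.2
    unfold graininess
    linarith
  · push Not at hmax
    filter_upwards [self_mem_nhdsWithin] with s hs
    obtain rfl : s = t := le_antisymm (hmax s hs.1) hs.2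
    simpa [graininess, h] using hb

lemma RdContinuous.zeta {α : ℝ → ℂ} (hα : RdContinuous T α) :
    RdContinuous T fun s => zeta (graininess T s) (α s) := by
  refine ⟨fun t ht h => ?_, fun t ht h => ?_⟩
  · have hval : TimeScale.zeta (graininess T t) (α t) = α t := by
      simp [TimeScale.zeta, graininess, h]
    unfold ContinuousWithinAt
    beta_reduce
    rw [hval]
    exact tendsto_zeta (tendsto_graininess_of_sigma_eq ht h) (hα.1 t ht h)
  · obtain ⟨l, hl⟩ := hα.2 t ht h
    exact ⟨l, tendsto_zeta (tendsto_graininess_left ht) hl⟩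

/-! ### The Cayley-exponential function -/

lemma exp_mul_zeta {m : ℝ} {z : ℂ} (h1 : (m : ℂ) * z ≠ 2) (h2 : (m : ℂ) * z ≠ -2) :
    Complex.exp ((m : ℂ) * zeta m z) = (1 + z * (m : ℂ) / 2) / (1 - z * (m : ℂ) / 2) := by
  unfold zeta
  split_ifs with hm
  · simp [hm]
  · have hm' : (m : ℂ) ≠ 0 := Complex.ofReal_ne_zero.2 hm
    rw [← mul_assoc, mul_one_div_cancel hm', one_mul, Complex.exp_log]
    refine div_ne_zero (fun h => h2 ?_) (fun h => h1 ?_)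
    · linear_combination 2 * h
    · linear_combination -2 * h

lemma eq_two_div_mul_tanh_zeta {m : ℝ} {z : ℂ} (hm : m ≠ 0) (h1 : (m : ℂ) * z ≠ 2)
    (h2 : (m : ℂ) * z ≠ -2) :
    z = (2 / (m : ℂ)) * Complex.tanh ((m : ℂ) * zeta m z / 2) := by
  have hm' : (m : ℂ) ≠ 0 := Complex.ofReal_ne_zero.2 hm
  have hden : 1 - z * (m : ℂ) / 2 ≠ 0 := fun h => h1 (by linear_combination -2 * h)
  have hexp := exp_mul_zeta h1 h2
  set v := (m : ℂ) * zeta m z / 2 with hv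
  have hv2 : (m : ℂ) * zeta m z = v + v := by rw [hv]; ring
  have hne := Complex.exp_ne_zero v
  rw [hv2, Complex.exp_add, eq_div_iff hden] at hexp
  -- If `cosh v = 0` then `exp (2v) = -1`, and `hexp` would give `-1 = 1`.
  have hcosh : Complex.exp v + (Complex.exp v)⁻¹ ≠ 0 := by
    intro h
    have h3 : Complex.exp v * Complex.exp v = -1 := by
      have := congrArg (· * Complex.exp v) h
      simp only [add_mul, inv_mul_cancel₀ hne, zero_mul] at this
      linear_combination this
    rw [h3] at hexp
    exact two_ne_zero (α := ℂ) (by linear_combination -hexp)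
  rw [Complex.tanh_eq_sinh_div_cosh, Complex.sinh, Complex.cosh, Complex.exp_neg,
    div_div_div_cancel_right₀ two_ne_zero, ← mul_div_assoc, eq_div_iff hcosh]
  field_simp
  linear_combination -2 * hexp

lemma cayley_step_iff {m : ℝ} {z a b : ℂ} (h1 : (m : ℂ) * z ≠ 2) (h2 : (m : ℂ) * z ≠ -2) :
    b - a = (m : ℂ) * (z * ((a + b) / 2)) ↔ b = a * Complex.exp ((m : ℂ) * zeta m z) := by
  have hden : 1 - z * (m : ℂ) / 2 ≠ 0 := fun h => h1 (by linear_combination -2 * h)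
  rw [exp_mul_zeta h1 h2, ← mul_div_assoc a, eq_div_iff hden]
  constructor <;> intro h <;> linear_combination h

lemma isCayleyExp_exp {α F x : ℝ → ℂ} (hT : IsClosed T) (hreg : Regressive T α)
    (hF : IsDeltaAntideriv T F fun s => zeta (graininess T s) (α s)) {t₀ : ℝ} (ht₀ : t₀ ∈ T)
    (hx : ∀ t ∈ T, x t = Complex.exp (F t - F t₀)) : IsCayleyExp T α t₀ x := by
  refine ⟨fun t ht => ?_, by simp [hx t₀ ht₀]⟩
  rcases (le_sigma T t).lt_or_eq with h | h
  · obtain ⟨hc, hval⟩ := (hasDeltaDerivAt_iff_of_lt ht h).1 (hF t ht)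
    refine (hasDeltaDerivAt_iff_of_lt ht h).2 ⟨?_, ?_⟩
    · exact (hc.sub continuousWithinAt_const).cexp.congr hx (hx t ht)
    · refine (cayley_step_iff (hreg t ht).1 (hreg t ht).2).2 ?_
      rw [hx _ (sigma_mem hT ht), hx t ht, ← Complex.exp_add, ← hval]
      congr 1
      ring
  · have hd := (hasDeltaDerivAt_iff_of_eq h.symm).1 (hF t ht)
    refine (hasDeltaDerivAt_iff_of_eq h.symm).2
      ((((hd.sub_const (F t₀)).cexp).congr hx (hx t ht)).congr_deriv ?_)
    simp [average, ← h, graininess, zeta, hx t ht, mul_comm]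

lemma IsCayleyExp.eq_exp {α F x : ℝ → ℂ} (hT : IsClosed T) (hreg : Regressive T α)
    (hF : IsDeltaAntideriv T F fun s => zeta (graininess T s) (α s)) {t₀ : ℝ} (ht₀ : t₀ ∈ T)
    (hx : IsCayleyExp T α t₀ x) : ∀ t ∈ T, x t = Complex.exp (F t - F t₀) := by
  have hq : ∀ t ∈ T, HasDeltaDerivAt T (fun s => x s * Complex.exp (-(F s - F t₀))) 0 t := by
    intro t ht
    rcases (le_sigma T t).lt_or_eq with h | h
    · obtain ⟨hFc, hFv⟩ := (hasDeltaDerivAt_iff_of_lt ht h).1 (hF t ht)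
      obtain ⟨hxc, hxv⟩ := (hasDeltaDerivAt_iff_of_lt ht h).1 (hx.1 t ht)
      refine (hasDeltaDerivAt_iff_of_lt ht h).2
        ⟨hxc.mul (hFc.sub continuousWithinAt_const).neg.cexp, ?_⟩
      have hstep := (cayley_step_iff (hreg t ht).1 (hreg t ht).2).1 hxv
      rw [mul_zero, sub_eq_zero, hstep, ← hFv, mul_assoc, ← Complex.exp_add]
      congr 2
      ring
    · have hFd := (hasDeltaDerivAt_iff_of_eq h.symm).1 (hF t ht)
      have hxd := (hasDeltaDerivAt_iff_of_eq h.symm).1 (hx.1 t ht)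
      refine (hasDeltaDerivAt_iff_of_eq h.symm).2
        ((hxd.fun_mul (hFd.sub_const (F t₀)).fun_neg.cexp).congr_deriv ?_)
      simp only [average, ← h, graininess, zeta, sub_self, if_true]
      ring
  intro t ht
  have h := eq_of_hasDeltaDerivAt_zero hT hq ht₀ ht
  simp only [sub_self, neg_zero, Complex.exp_zero, mul_one, hx.2] at h
  rw [Complex.exp_neg] at h
  exact (mul_inv_eq_one₀ (Complex.exp_ne_zero _)).1 h

end TimeScale

theorem mainTheorem2 (T : Set ℝ) (hT : IsClosed T) (α : ℝ → ℂ)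
    (hreg : TimeScale.Regressive T α) (hrd : TimeScale.RdContinuous T α)
    (t₀ : ℝ) (ht₀ : t₀ ∈ T) :
    TimeScale.DeltaIntegrable T (fun s => TimeScale.zeta (TimeScale.graininess T s) (α s)) ∧
    (∀ x : ℝ → ℂ, TimeScale.IsCayleyExp T α t₀ x ↔
      ∀ t ∈ T, x t = Complex.exp (TimeScale.deltaIntegral T
        (fun s => TimeScale.zeta (TimeScale.graininess T s) (α s)) t₀ t)) ∧
    (∀ (m : ℝ) (z : ℂ), m ≠ 0 → (m : ℂ) * z ≠ 2 → (m : ℂ) * z ≠ -2 →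
      z = (2 / (m : ℂ)) * Complex.tanh ((m : ℂ) * TimeScale.zeta m z / 2)) := by
  have hint := hrd.zeta.deltaIntegrable hT
  -- The integral uses a chosen antiderivative; the lemmas above hold for any.
  have heq : ∀ t, TimeScale.deltaIntegral T
      (fun s => TimeScale.zeta (TimeScale.graininess T s) (α s)) t₀ t =
      hint.choose t - hint.choose t₀ := fun t => dif_pos hint
  refine ⟨hint, fun x => ?_, fun m z => TimeScale.eq_two_div_mul_tanh_zeta⟩
  simp only [heq]
  exact ⟨TimeScale.IsCayleyExp.eq_exp hT hreg hint.choose_spec ht₀,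
    TimeScale.isCayleyExp_exp hT hreg hint.choose_spec ht₀⟩
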